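/- Let $n \ge 1$ and let $R=\mathbb{C}[x_1,\dots,x_n]$ with its standard grading. An unordered sequence $(d_1,\dots,d_n)$ of positive integers is called a *regular degree sequence* if there are nonzero homogeneous symmetric polynomials $f_1,\dots,f_n\in R$ with $\deg f_i=d_i$ which form a regular sequence in $R$, that is, whose only common zero in $\mathbb{C}^n$ is the origin. Consider the conditions $$(*)\qquad \#\{j : i \mid d_j\}\ \ge\ \lfloor n/i\rfloor \quad\text{for all } i=1,\dots,n,$$ $$(\dagger)\qquad \#\{j : d_j\le i\}\ \le\ i \quad\text{for all } i=1,\dots,n,$$ and call $(d_1,\dots,d_n)$ *permissible* if it satisfies both $(*)$ and $(\dagger)$. 1. For $n=2$, a sequence of positive integers is a regular degree sequence if and only if it is permissible, if and only if it satisfies $(*)$. 2. For $n=3$, a sequence of positive integers is a regular degree sequence if and only if it is permissible. 3. For $n=4$, every permissible sequence of positive integers is a regular degree sequence, except for the sequences $(1,2,5,12\delta)$, $(2,2,5,12\delta)$ and $(5,2,5,12\delta)$ with $\delta$ a positive integer (up to reordering), which are permissible but are not regular degree sequences. -/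

import Mathlib

namespace SymRegSeq

/-- A family `f` of `n` polynomials in `ℂ[x₁, …, xₙ]` is a maximal regular sequence of homogeneous
polynomials of degrees `d 0, …, d (n - 1)`: every `f i` is a nonzero homogeneous polynomial of
degree `d i`, and the only common zero in `ℂⁿ` of the `n` polynomials is the origin. -/
structure IsHomogeneousMaximalRegular {n : ℕ} (d : Fin n → ℕ)
    (f : Fin n → MvPolynomial (Fin n) ℂ) : Prop where
  ne_zero : ∀ i, f i ≠ 0
  isHomogeneous : ∀ i, (f i).IsHomogeneous (d i)
  common_zero_iff : ∀ x : Fin n → ℂ, (∀ i, MvPolynomial.eval x (f i) = 0) ↔ x = 0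

/-- `d` is a regular degree sequence: some homogeneous regular sequence of `n` symmetric
polynomials in `n` variables over `ℂ` has degrees `d`. -/
def IsRegularDegreeSequence {n : ℕ} (d : Fin n → ℕ) : Prop :=
  ∃ f : Fin n → MvPolynomial (Fin n) ℂ,
    (∀ i, (f i).IsSymmetric) ∧ IsHomogeneousMaximalRegular d f

/-- Condition `(*)`: for `1 ≤ i ≤ n`, at least `⌊n / i⌋` of the degrees are divisible by `i`. -/
def StarCondition {n : ℕ} (d : Fin n → ℕ) : Prop :=
  ∀ i : ℕ, 1 ≤ i → i ≤ n → n / i ≤ (Finset.univ.filter fun j => i ∣ d j).card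

/-- Condition `(†)`: for `1 ≤ i ≤ n`, at most `i` of the degrees are at most `i`. -/
def DaggerCondition {n : ℕ} (d : Fin n → ℕ) : Prop :=
  ∀ i : ℕ, 1 ≤ i → i ≤ n → (Finset.univ.filter fun j => d j ≤ i).card ≤ i

/-- A sequence is permissible if it satisfies both `(*)` and `(†)`. -/
def IsPermissible {n : ℕ} (d : Fin n → ℕ) : Prop :=
  StarCondition d ∧ DaggerCondition d

/-- `d` is, up to reordering, one of `(1, 2, 5, 12δ)`, `(2, 2, 5, 12δ)`, `(5, 2, 5, 12δ)` with `δ` a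
positive integer. -/
def IsExceptional (d : Fin 4 → ℕ) : Prop :=
  ∃ δ : ℕ, 0 < δ ∧ ∃ σ : Equiv.Perm (Fin 4),
    d ∘ σ = ![1, 2, 5, 12 * δ] ∨ d ∘ σ = ![2, 2, 5, 12 * δ] ∨ d ∘ σ = ![5, 2, 5, 12 * δ]

end SymRegSeq

/-!
By the fundamental theorem of symmetric polynomials, a symmetric form of degree `d` in
`x₁, …, xₙ` is the same as a weighted homogeneous polynomial of degree `d` in variables
`y₁, …, yₙ` of weights `1, …, n`, evaluated at `yᵢ = eᵢ(x)`. The map `x ↦ (e₁(x), …, eₙ(x))` from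
`ℂⁿ` to itself is surjective, and only the origin is sent to the origin. So `d` is a regular degree
sequence if and only if some nonzero weighted homogeneous polynomials `gⱼ(y)` of degrees `dⱼ` have
the origin as their only common zero
(`SymRegSeq.isRegularDegreeSequence_iff_exists_isWeightedHomogeneous`).

Such `gⱼ` exist as soon as, for every nonempty set `I` of variables, at least `|I|` of the degrees
`dⱼ` are sums of weights of variables in `I`
(`exists_isWeightedHomogeneous_forall_eval_eq_zero`). Take all the coefficients algebraically
independent over `ℚ`. Let `y` be a common zero with support `I ≠ ∅`, rescaled so that one of its
coordinates is `1`. For `|I|` of the indices `j`, the equation `gⱼ(y) = 0` expresses one coefficient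
through the other coefficients and the `|I| - 1` remaining coordinates of `y`, so a field generated
by fewer elements than there are coefficients contains all of them, which is impossible.

Conversely, if `gⱼ` does not vanish at a point supported in `I`, then `dⱼ` is a sum of weights of
variables in `I`. A point on a coordinate axis gives the cases of `(*)` that are needed
(`SymRegSeq.IsRegularDegreeSequence.exists_dvd`). A weighted homogeneous polynomial of positive
degree has a nontrivial zero in every coordinate plane, so at least two of the degrees are sums of
the weights of two given variables (`SymRegSeq.IsRegularDegreeSequence.exists_pair`).

For `n ≤ 4` what is left is arithmetic. A number is a sum of `2`s and `3`s unless it is `1`, and a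
sum of `3`s and `4`s unless it is `1`, `2` or `5`. For `n = 4` and the variables of weights `3` and
`4`, permissibility does not force two degrees outside `{1, 2, 5}`, and it fails to do so exactly
for the exceptional sequences.
-/

section

open MvPolynomial

/-! ### Algebraically independent families -/

/-- In the matroid of algebraic independence, the span of `S` has rank at most `#S`. -/
theorem AlgebraicIndependent.card_le_of_mem_adjoin {κ F K : Type*} [Field F] [Field K]
    [Algebra F K] {c : κ → K} (hc : AlgebraicIndependent F c) (T : Finset κ) (S : Finset K)
    (h : ∀ t ∈ T, c t ∈ IntermediateField.adjoin F (S : Set K)) : T.card ≤ S.card := by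
  classical
  have hinj : Function.Injective c := hc.injective
  let M := AlgebraicIndependent.matroid F K
  have hind : M.Indep (c '' T) := by
    rw [AlgebraicIndependent.matroid_indep_iff]
    exact hc.to_subtype_range.mono (Set.image_subset_range _ _)
  have hsub : c '' T ⊆ M.closure S := by
    rw [AlgebraicIndependent.matroid_closure_eq]
    rintro _ ⟨t, ht, rfl⟩
    obtain ⟨r, hr, s, hs, e⟩ := IntermediateField.mem_adjoin_iff_div.1 (h t ht)
    have key : IsAlgebraic (Algebra.adjoin F (S : Set K)) (c t) := by
      rw [e, div_eq_mul_inv]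
      exact (isAlgebraic_algebraMap (⟨r, hr⟩ : Algebra.adjoin F (S : Set K))).mul
        (isAlgebraic_algebraMap (⟨s, hs⟩ : Algebra.adjoin F (S : Set K))).inv
    exact key
  have h1 := hind.encard_le_eRk_of_subset hsub
  rw [M.eRk_closure_eq] at h1
  have h2 := h1.trans (M.eRk_le_encard _)
  rw [hinj.encard_image, Set.encard_coe_eq_coe_finsetCard, Set.encard_coe_eq_coe_finsetCard] at h2
  exact_mod_cast h2

theorem exists_algebraicIndependent_rat_complex (κ : Type) [Countable κ] :
    ∃ c : κ → ℂ, AlgebraicIndependent ℚ c := by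
  obtain ⟨s, hs⟩ := exists_isTranscendenceBasis ℚ ℂ
  have hcard : Cardinal.mk ℂ = Cardinal.mk s :=
    IsAlgClosed.cardinal_eq_cardinal_transcendence_basis_of_aleph0_lt' _ hs
      (by simp) (by simpa using Cardinal.aleph0_lt_continuum)
  have : Cardinal.mk κ ≤ Cardinal.mk s := by
    rw [← hcard]
    exact Cardinal.mk_le_aleph0.trans (by simpa using Cardinal.aleph0_le_continuum)
  obtain ⟨e⟩ := Cardinal.le_def _ _ |>.1 this
  exact ⟨fun k => (e k : ℂ), hs.1.comp e e.injective⟩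

/-! ### Generic weighted homogeneous polynomials -/

theorem AddSubmonoid.mem_closure_image_iff_exists_weight {σ : Type*} [Finite σ] (w : σ → ℕ)
    (I : Set σ) (d : ℕ) :
    d ∈ AddSubmonoid.closure (w '' I) ↔
      ∃ m : σ →₀ ℕ, ↑m.support ⊆ I ∧ Finsupp.weight w m = d := by
  classical
  constructor
  · intro h
    induction h using AddSubmonoid.closure_induction with
    | mem x hx =>
      obtain ⟨i, hi, rfl⟩ := hx
      refine ⟨Finsupp.single i 1, ?_, by simp [Finsupp.weight_single]⟩
      intro k hk
      have := Finsupp.support_single_subset hk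
      simp_all
    | zero => exact ⟨0, by simp, by simp⟩
    | add x y _ _ hx hy =>
      obtain ⟨m, hm, rfl⟩ := hx
      obtain ⟨m', hm', rfl⟩ := hy
      refine ⟨m + m', fun k hk => ?_, map_add _ _ _⟩
      rcases Finset.mem_union.1 (Finsupp.support_add hk) with h | h
      exacts [hm h, hm' h]
  · rintro ⟨m, hm, rfl⟩
    rw [Finsupp.weight_apply]
    exact AddSubmonoid.sum_mem _ fun i hi =>
      nsmul_mem (AddSubmonoid.subset_closure (Set.mem_image_of_mem w (hm hi))) _

theorem MvPolynomial.IsWeightedHomogeneous.eval_pow_mul {σ R : Type*} [CommSemiring R]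
    {w : σ → ℕ} {g : MvPolynomial σ R} {d : ℕ} (hg : g.IsWeightedHomogeneous w d) (a : R)
    (y : σ → R) : eval (fun i => a ^ w i * y i) g = a ^ d * eval y g := by
  rw [eval_eq, eval_eq, Finset.mul_sum]
  refine Finset.sum_congr rfl fun m hm => ?_
  have := hg (mem_support_iff.1 hm)
  rw [Finsupp.weight_apply, Finsupp.sum] at this
  simp_rw [mul_pow, Finset.prod_mul_distrib, ← pow_mul, Finset.prod_pow_eq_pow_sum]
  rw [← this]
  simp_rw [smul_eq_mul, mul_comm (w _)]
  ring

open scoped Classical in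
/-- If for every nonempty set `I` of variables at least `#I` of the numbers `d j` are sums of weights
of variables in `I`, then polynomials of weighted degrees `d j` whose coefficients are algebraically
independent over `ℚ` have no common zero other than the origin. -/
theorem exists_isWeightedHomogeneous_forall_eval_eq_zero {σ ι : Type} [Fintype σ] [Fintype ι]
    (w : σ → ℕ) (hw : ∀ i, w i ≠ 0) (d : ι → ℕ)
    (hd : ∀ I : Finset σ, I.Nonempty →
      I.card ≤ (Finset.univ.filter fun j => d j ∈ AddSubmonoid.closure (w '' I)).card) :
    ∃ g : ι → MvPolynomial σ ℂ, (∀ j, (g j).IsWeightedHomogeneous w (d j)) ∧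
      (∀ j m, Finsupp.weight w m = d j → (g j).coeff m ≠ 0) ∧
      ∀ y : σ → ℂ, (∀ j, eval y (g j) = 0) → y = 0 := by
  classical
  obtain ⟨c, hc⟩ := exists_algebraicIndependent_rat_complex (Σ _ : ι, σ →₀ ℕ)
  have hfin (j : ι) : {m : σ →₀ ℕ | Finsupp.weight w m = d j}.Finite :=
    (Finsupp.finite_of_nat_weight_le w hw (d j)).subset fun m hm => le_of_eq hm
  let M (j : ι) : Finset (σ →₀ ℕ) := (hfin j).toFinset
  have hM (j m) : m ∈ M j ↔ Finsupp.weight w m = d j := by simp [M]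
  let g (j : ι) : MvPolynomial σ ℂ := ∑ m ∈ M j, monomial m (c ⟨j, m⟩)
  have hg (j) : (g j).IsWeightedHomogeneous w (d j) :=
    IsWeightedHomogeneous.sum _ _ _ fun m hm =>
      isWeightedHomogeneous_monomial _ _ _ ((hM j m).1 hm)
  refine ⟨g, hg, fun j m hm => ?_, ?_⟩
  · have : (g j).coeff m = c ⟨j, m⟩ := by
      simp [g, coeff_sum, coeff_monomial, (hM j m).2 hm]
    rw [this]
    exact hc.ne_zero _
  intro y hy
  by_contra hy0
  -- Rescale `y` along its weighted orbit to a common zero `z` with `z i₀ = 1`.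
  obtain ⟨i₀, hi₀⟩ := Function.ne_iff.1 hy0
  obtain ⟨a, ha⟩ := IsAlgClosed.exists_pow_nat_eq (y i₀)⁻¹ (Nat.pos_of_ne_zero (hw i₀))
  have ha0 : a ≠ 0 := by
    rintro rfl
    rw [zero_pow (hw i₀)] at ha
    exact hi₀ (inv_eq_zero.1 ha.symm)
  let z : σ → ℂ := fun i => a ^ w i * y i
  have hz (j) : eval z (g j) = 0 := by rw [(hg j).eval_pow_mul, hy j, mul_zero]
  have hz₀ : z i₀ = 1 := by simp only [z, ha]; exact inv_mul_cancel₀ hi₀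
  let I : Finset σ := Finset.univ.filter fun i => z i ≠ 0
  have hi₀I : i₀ ∈ I := by simp [I, hz₀]
  -- Choose `#I` of the polynomials and in each a monomial `p j` that does not vanish at `z`.
  obtain ⟨J, hJ, hJc⟩ := Finset.exists_subset_card_eq (hd I ⟨i₀, hi₀I⟩)
  have hex (j : ι) (hj : j ∈ J) : ∃ m : σ →₀ ℕ, m.support ⊆ I ∧ m ∈ M j := by
    obtain ⟨m, h1, h2⟩ := (AddSubmonoid.mem_closure_image_iff_exists_weight w _ _).1
      (Finset.mem_filter.1 (hJ hj)).2
    exact ⟨m, by exact_mod_cast h1, (hM j m).2 h2⟩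
  choose! p hpI hpM using hex
  -- `T` indexes all coefficients, `U` those of the chosen monomials. The equations `g j (z) = 0`
  -- express the latter through `S`, which has fewer elements than `T` because `z i₀` is omitted.
  let T : Finset (Σ _ : ι, σ →₀ ℕ) := Finset.univ.sigma M
  let U : Finset (Σ _ : ι, σ →₀ ℕ) := J.image fun j => ⟨j, p j⟩
  have hUc : U.card = I.card := by
    rw [← hJc]
    exact Finset.card_image_of_injective _ fun j k h => congrArg Sigma.fst h
  have hUT : U ⊆ T := by
    intro t ht
    obtain ⟨j, hj, rfl⟩ := Finset.mem_image.1 ht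
    simp [T, hpM j hj]
  let S : Finset ℂ := (T \ U).image c ∪ (I.erase i₀).image z
  have hcard : T.card ≤ S.card := by
    refine hc.card_le_of_mem_adjoin T S fun t ht => ?_
    set A := IntermediateField.adjoin ℚ (S : Set ℂ)
    have hS (x) (hx : x ∈ S) : x ∈ A := IntermediateField.subset_adjoin _ _ (by exact_mod_cast hx)
    have hcA (t) (h1 : t ∈ T) (h2 : t ∉ U) : c t ∈ A :=
      hS _ (Finset.mem_union_left _ (Finset.mem_image_of_mem _ (Finset.mem_sdiff.2 ⟨h1, h2⟩)))
    have hzA (i) : z i ∈ A := by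
      by_cases h : i = i₀
      · rw [h, hz₀]; exact one_mem _
      by_cases h' : z i = 0
      · rw [h']; exact zero_mem _
      · exact hS _ (Finset.mem_union_right _ (Finset.mem_image_of_mem _ (by simp [h, I, h'])))
    by_cases htU : t ∈ U
    swap
    · exact hcA t ht htU
    obtain ⟨j, hj, rfl⟩ := Finset.mem_image.1 htU
    have hmono (m : σ →₀ ℕ) : (m.prod fun i k => z i ^ k) ∈ A :=
      prod_mem fun i _ => pow_mem (hzA i) _
    have hp0 : ((p j).prod fun i k => z i ^ k) ≠ 0 :=
      Finset.prod_ne_zero_iff.2 fun i hi =>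
        pow_ne_zero _ (Finset.mem_filter.1 (hpI j hj hi)).2
    have hsum : c ⟨j, p j⟩ * ((p j).prod fun i k => z i ^ k) +
        ∑ m ∈ (M j).erase (p j), c ⟨j, m⟩ * (m.prod fun i k => z i ^ k) = 0 := by
      rw [Finset.add_sum_erase _ (fun m => c ⟨j, m⟩ * (m.prod fun i k => z i ^ k)) (hpM j hj),
        ← hz j]
      simp [g, eval_monomial]
    rw [eq_div_of_mul_eq hp0 (eq_neg_of_add_eq_zero_left hsum)]
    refine div_mem (neg_mem (sum_mem fun m hm => mul_mem (hcA _ ?_ ?_) (hmono m))) (hmono _)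
    · simp [T, Finset.mem_of_mem_erase hm]
    · intro h
      obtain ⟨k, hk, e⟩ := Finset.mem_image.1 h
      cases e
      simp at hm
  have h1 : S.card ≤ (T \ U).card + (I.erase i₀).card :=
    (Finset.card_union_le _ _).trans (Nat.add_le_add Finset.card_image_le Finset.card_image_le)
  have h2 := Finset.card_sdiff_add_card_eq_card hUT
  have h3 := Finset.card_erase_add_one hi₀I
  omega

/-! ### Symmetric polynomials as polynomials in the elementary symmetric ones -/

namespace SymRegSeq

/-- The weights `1, 2, …, n`: the variable that stands for `eᵢ₊₁` has weight `i + 1`. -/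
def esymmWeight (n : ℕ) (i : Fin n) : ℕ := i + 1

/-- The point of `ℂⁿ` whose coordinates are the elementary symmetric functions
`e₁, …, eₙ` of `x₁, …, xₙ`. -/
noncomputable def esymmPoint {n : ℕ} (x : Fin n → ℂ) (i : Fin n) : ℂ :=
  eval x (esymm (Fin n) ℂ (i + 1))

/-- The coordinates of a preimage of `y` are the roots of the monic polynomial whose coefficients
are, up to sign, the coordinates of `y`. -/
theorem esymmPoint_surjective (n : ℕ) :
    Function.Surjective (esymmPoint : (Fin n → ℂ) → Fin n → ℂ) := by
  intro y
  let a : Fin n → ℂ := fun i => (-1) ^ (n - (i : ℕ)) * y i.rev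
  let q : Polynomial ℂ := ∑ i : Fin n, Polynomial.C (a i) * Polynomial.X ^ (i : ℕ)
  let p : Polynomial ℂ := Polynomial.X ^ n + q
  have hq : q.degree < n := Polynomial.degree_sum_fin_lt a
  have hp : p.Monic := Polynomial.monic_X_pow_add hq
  have hdeg : p.natDegree = n := Polynomial.natDegree_eq_of_degree_eq_some
    ((Polynomial.degree_add_eq_left_of_degree_lt (by simpa using hq)).trans (by simp))
  have hsplit : p.Splits := IsAlgClosed.splits p
  have hcard : p.roots.card = n := (Polynomial.splits_iff_card_roots.1 hsplit).trans hdeg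
  have hl : p.roots.toList.length = n := by simpa using hcard
  let x : Fin n → ℂ := fun i => p.roots.toList.get (i.cast hl.symm)
  have hx : Multiset.map x Finset.univ.val = p.roots := by
    have h1 : List.ofFn x = p.roots.toList := by
      apply List.ext_get (by simp [hl])
      intro m h1 h2
      simp [x]
    rw [Fin.univ_val_map, h1, Multiset.coe_toList]
  refine ⟨x, funext fun i => ?_⟩
  have hi := i.2
  have h1 := Polynomial.coeff_eq_esymm_roots_of_splits hsplit
    (k := n - (i + 1)) (by omega)
  have h2 : n - (n - (i + 1)) = (i : ℕ) + 1 := by omega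
  rw [hdeg, hp.leadingCoeff, one_mul, h2] at h1
  have h3 : p.coeff (n - (i + 1)) = (-1) ^ ((i : ℕ) + 1) * y i := by
    have h4 : n - ((i : ℕ) + 1) ≠ n := by omega
    have h5 : q.coeff (i.rev : ℕ) = a i.rev := by
      simp only [q, Polynomial.finsetSum_coeff, Polynomial.coeff_C_mul, Polynomial.coeff_X_pow,
        Fin.val_inj, mul_ite, mul_one, mul_zero, Finset.sum_ite_eq, Finset.mem_univ, if_true]
    have h6 : (i.rev : ℕ) = n - (i + 1) := Fin.val_rev i
    have h7 : n - (i.rev : ℕ) = (i : ℕ) + 1 := by omega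
    rw [Polynomial.coeff_add, Polynomial.coeff_X_pow, if_neg h4, zero_add, ← h6, h5]
    simp only [a, Fin.rev_rev, h7]
  have h8 : esymmPoint x i = p.roots.esymm (i + 1) := by
    rw [← hx, ← aeval_esymm_eq_multiset_esymm (Fin n) ℂ, aeval_eq_eval]
    rfl
  rw [h8]
  exact mul_left_cancel₀ (pow_ne_zero _ (neg_ne_zero.2 one_ne_zero)) (h1.symm.trans h3)

theorem esymmPoint_eq_zero_iff {n : ℕ} (x : Fin n → ℂ) : esymmPoint x = 0 ↔ x = 0 := by
  constructor
  · intro h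
    have h0 (k : ℕ) (hk : k < n) : (Multiset.map x Finset.univ.val).esymm (k + 1) = 0 := by
      rw [← aeval_esymm_eq_multiset_esymm (Fin n) ℂ, aeval_eq_eval]
      exact congrFun h ⟨k, hk⟩
    have h1 := Multiset.prod_X_sub_X_eq_sum_esymm (Multiset.map x Finset.univ.val)
    have h2 : (Multiset.map x Finset.univ.val).esymm 0 = 1 := by
      simp only [Multiset.esymm, Multiset.powersetCard_zero_left, Multiset.map_singleton,
        Multiset.prod_zero, Multiset.sum_singleton]
    rw [Finset.sum_range_succ', Finset.sum_eq_zero, zero_add, h2] at h1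
    · funext i
      -- If all `eₖ(x)` vanish, then `∏ (X - x i) = X ^ n`; evaluate at `x i`.
      have h3 := congrArg (Polynomial.eval (x i)) h1
      rw [Polynomial.eval_multiset_prod, Multiset.prod_eq_zero] at h3
      · have h4 : x i ^ n = 0 := by simpa using h3.symm
        exact eq_zero_of_pow_eq_zero h4
      · simp only [Multiset.map_map, Multiset.mem_map]
        exact ⟨i, by simp, by simp⟩
    · intro k hk
      rw [h0 k (by simpa using hk)]
      simp
  · rintro rfl
    funext i
    rw [esymmPoint, esymm, map_sum]
    refine Finset.sum_eq_zero fun s hs => ?_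
    obtain ⟨k, hk⟩ : s.Nonempty := Finset.card_pos.1 (by
      rw [(Finset.mem_powersetCard.1 hs).2]; exact Nat.succ_pos _)
    rw [map_prod]
    exact Finset.prod_eq_zero hk (eval_X k)

theorem _root_.MvPolynomial.isHomogeneous_esymm (σ R : Type*) [Fintype σ] [CommSemiring R]
    (k : ℕ) : (esymm σ R k).IsHomogeneous k := by
  refine IsHomogeneous.sum _ _ _ fun s hs => ?_
  have := IsHomogeneous.prod s (fun i => (X i : MvPolynomial σ R)) (fun _ => 1)
    fun i _ => isHomogeneous_X R i
  simpa [(Finset.mem_powersetCard.1 hs).2] using this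

theorem isHomogeneous_aeval_esymm {n d : ℕ} {g : MvPolynomial (Fin n) ℂ}
    (hg : g.IsWeightedHomogeneous (esymmWeight n) d) :
    (aeval (fun i : Fin n => esymm (Fin n) ℂ (i + 1)) g).IsHomogeneous d := by
  rw [aeval_def, eval₂_eq]
  refine IsHomogeneous.sum _ _ _ fun m hm => IsHomogeneous.C_mul ?_ _
  have h := hg (mem_support_iff.1 hm)
  rw [Finsupp.weight_apply, Finsupp.sum] at h
  rw [← h]
  refine IsHomogeneous.prod _ _ _ fun i _ => ?_
  have := (isHomogeneous_esymm (Fin n) ℂ (i + 1)).pow (m i)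
  rwa [mul_comm] at this

/-- Substituting elementary symmetric polynomials carries weight to degree, so it commutes with
taking components. -/
theorem homogeneousComponent_aeval_esymm {n : ℕ} (d : ℕ) (g : MvPolynomial (Fin n) ℂ) :
    homogeneousComponent d (aeval (fun i : Fin n => esymm (Fin n) ℂ (i + 1)) g) =
      aeval (fun i : Fin n => esymm (Fin n) ℂ (i + 1))
        (weightedHomogeneousComponent (esymmWeight n) d g) := by
  induction g using MvPolynomial.induction_on' with
  | monomial m r =>
    have hm := isWeightedHomogeneous_monomial (esymmWeight n) m r rfl
    rw [homogeneousComponent_of_mem (isHomogeneous_aeval_esymm hm),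
      weightedHomogeneousComponent_of_mem hm]
    split_ifs <;> simp
  | add p q hp hq => simp only [map_add, hp, hq]

theorem exists_isWeightedHomogeneous_aeval_esymm {n d : ℕ} {f : MvPolynomial (Fin n) ℂ}
    (hs : f.IsSymmetric) (hf : f.IsHomogeneous d) :
    ∃ g : MvPolynomial (Fin n) ℂ, g.IsWeightedHomogeneous (esymmWeight n) d ∧
      aeval (fun i : Fin n => esymm (Fin n) ℂ (i + 1)) g = f := by
  obtain ⟨g, hg⟩ := esymmAlgHom_surjective (σ := Fin n) ℂ (n := n) (by simp) ⟨f, hs⟩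
  have hg' : aeval (fun i : Fin n => esymm (Fin n) ℂ (i + 1)) g = f := by
    rw [← esymmAlgHom_apply, hg]
  refine ⟨weightedHomogeneousComponent (esymmWeight n) d g,
    weightedHomogeneousComponent_isWeightedHomogeneous d g, ?_⟩
  rw [← homogeneousComponent_aeval_esymm, hg', homogeneousComponent_eq_self hf]

theorem eval_aeval_esymm {n : ℕ} (g : MvPolynomial (Fin n) ℂ) (x : Fin n → ℂ) :
    eval x (aeval (fun i : Fin n => esymm (Fin n) ℂ (i + 1)) g) = eval (esymmPoint x) g := by
  rw [← aeval_eq_eval, ← AlgHom.comp_apply, comp_aeval, ← aeval_eq_eval]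
  rfl

theorem isRegularDegreeSequence_iff_exists_isWeightedHomogeneous {n : ℕ} (d : Fin n → ℕ) :
    IsRegularDegreeSequence d ↔ ∃ g : Fin n → MvPolynomial (Fin n) ℂ,
      (∀ j, g j ≠ 0) ∧ (∀ j, (g j).IsWeightedHomogeneous (esymmWeight n) (d j)) ∧
      ∀ y : Fin n → ℂ, (∀ j, eval y (g j) = 0) ↔ y = 0 := by
  constructor
  · rintro ⟨f, hs, hf⟩
    choose g hg hgf using fun j =>
      exists_isWeightedHomogeneous_aeval_esymm (hs j) (hf.isHomogeneous j)
    refine ⟨g, fun j h => hf.ne_zero j (by rw [← hgf, h, map_zero]), hg, fun y => ?_⟩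
    obtain ⟨x, rfl⟩ := esymmPoint_surjective n y
    rw [esymmPoint_eq_zero_iff, ← hf.common_zero_iff]
    simp only [← hgf, eval_aeval_esymm]
  · rintro ⟨g, hg0, hg, hgy⟩
    refine ⟨fun j => aeval (fun i : Fin n => esymm (Fin n) ℂ (i + 1)) (g j), fun j => ?_,
      fun j h => ?_, fun j => isHomogeneous_aeval_esymm (hg j), fun x => ?_⟩
    · beta_reduce
      rw [← esymmAlgHom_apply]
      exact (esymmAlgHom (Fin n) ℂ n (g j)).2
    · refine hg0 j (esymmAlgHom_injective (σ := Fin n) ℂ (n := n) (by simp) (Subtype.ext ?_))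
      rw [esymmAlgHom_apply, h, map_zero]
      rfl
    · rw [← esymmPoint_eq_zero_iff, ← hgy]
      simp only [eval_aeval_esymm]

end SymRegSeq

/-! ### Zeros of weighted homogeneous polynomials on coordinate subspaces -/

/-- Two variables suffice for a nontrivial zero. Write `g(s, t)` for the value at the point with
`y i = s`, `y k = t` and other coordinates `0`. If `g(s, 1)` has no zero, it is a constant `c`;
then `g(1, t ^ w k) = t ^ d * c` for `t ≠ 0` by homogeneity, and `t → 0` gives `g(1, 0) = 0`. -/
theorem MvPolynomial.IsWeightedHomogeneous.exists_ne_zero_eval_eq_zero {σ : Type*}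
    {w : σ → ℕ} (hw : ∀ i, w i ≠ 0) {g : MvPolynomial σ ℂ} {d : ℕ}
    (hg : g.IsWeightedHomogeneous w d) (hd : d ≠ 0) {i k : σ} (hik : i ≠ k) :
    ∃ y : σ → ℂ, y ≠ 0 ∧ (∀ l, y l ≠ 0 → l = i ∨ l = k) ∧ eval y g = 0 := by
  classical
  let P (s t : ℂ) : σ → ℂ := fun l => if l = i then s else if l = k then t else 0
  have hPi (s t) : P s t i = s := by simp [P]
  have hPk (s t) : P s t k = t := by simp [P, hik.symm]
  have hP (s t l) (h : P s t l ≠ 0) : l = i ∨ l = k := by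
    by_contra! h'
    simp [P, h'] at h
  let p : Polynomial ℂ :=
    aeval (fun l => if l = i then Polynomial.X else if l = k then 1 else 0) g
  have hp (s : ℂ) : p.eval s = eval (P s 1) g := by
    rw [← Polynomial.coe_aeval_eq_eval, ← aeval_eq_eval, ← AlgHom.comp_apply, comp_aeval]
    congr 2
    funext l
    simp only [P]
    split_ifs <;> simp
  by_cases hdeg : p.degree = 0
  · obtain ⟨c, hc⟩ : ∃ c, p = Polynomial.C c := ⟨_, Polynomial.eq_C_of_degree_eq_zero hdeg⟩
    refine ⟨P 1 0, fun h => ?_, hP 1 0, ?_⟩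
    · simpa [hPi] using congrFun h i
    have hcont : Continuous fun t : ℂ => eval (P 1 (t ^ w k)) g := by
      refine g.continuous_eval.comp (continuous_pi fun l => ?_)
      simp only [P]
      split_ifs <;> fun_prop
    have heq : (fun t : ℂ => eval (P 1 (t ^ w k)) g) = fun t => t ^ d * c := by
      refine hcont.ext_on (dense_compl_singleton 0) (by fun_prop) fun t ht => ?_
      have ht0 : t ≠ 0 := ht
      have h1 : P 1 (t ^ w k) = fun l => t ^ w l * P ((t ^ w i)⁻¹) 1 l := by
        funext l
        simp only [P]
        split_ifs with h h'
        · rw [h, mul_inv_cancel₀ (pow_ne_zero _ ht0)]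
        · rw [h', mul_one]
        · rw [mul_zero]
      show eval (P 1 (t ^ w k)) g = t ^ d * c
      rw [h1, hg.eval_pow_mul, ← hp, hc, Polynomial.eval_C]
    simpa [hw k, hd] using congrFun heq 0
  · obtain ⟨s, hs⟩ := IsAlgClosed.exists_root p hdeg
    refine ⟨P s 1, fun h => ?_, hP s 1, by rw [← hp]; exact hs⟩
    simpa [hPk] using congrFun h k

/-- A polynomial that does not vanish at a point supported in `I` has a monomial in the variables
of `I` only. -/
theorem MvPolynomial.IsWeightedHomogeneous.mem_closure_of_eval_ne_zero {σ R : Type*} [Finite σ]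
    [CommSemiring R] {w : σ → ℕ} {g : MvPolynomial σ R} {d : ℕ}
    (hg : g.IsWeightedHomogeneous w d) {y : σ → R} {I : Set σ} (hy : ∀ l, y l ≠ 0 → l ∈ I)
    (h : eval y g ≠ 0) : d ∈ AddSubmonoid.closure (w '' I) := by
  rw [eval_eq] at h
  obtain ⟨m, hm, hne⟩ := Finset.exists_ne_zero_of_sum_ne_zero h
  refine (AddSubmonoid.mem_closure_image_iff_exists_weight w I d).2
    ⟨m, fun l hl => hy l fun h0 => hne ?_, hg (mem_support_iff.1 hm)⟩
  rw [Finset.prod_eq_zero hl, mul_zero]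
  rw [h0, zero_pow (Finsupp.mem_support_iff.1 hl)]

namespace SymRegSeq

/-! ### Conditions on regular degree sequences -/

theorem esymmWeight_ne_zero {n : ℕ} (i : Fin n) : esymmWeight n i ≠ 0 := Nat.succ_ne_zero _

theorem IsRegularDegreeSequence.exists_dvd {n : ℕ} {d : Fin n → ℕ}
    (h : IsRegularDegreeSequence d) (i : Fin n) : ∃ j, (i : ℕ) + 1 ∣ d j := by
  obtain ⟨g, -, hg, hy⟩ := (isRegularDegreeSequence_iff_exists_isWeightedHomogeneous d).1 h
  obtain ⟨j, hj⟩ := not_forall.1 fun h0 => one_ne_zero (α := ℂ)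
    (by simpa using congrFun ((hy (Pi.single i 1)).1 h0) i)
  have := (hg j).mem_closure_of_eval_ne_zero (I := {i})
    (fun l hl => by by_contra h'; exact hl (Pi.single_eq_of_ne h' _)) hj
  rw [Set.image_singleton, AddSubmonoid.mem_closure_singleton] at this
  obtain ⟨a, ha⟩ := this
  exact ⟨j, a, by rw [← ha, smul_eq_mul, mul_comm]; rfl⟩

/-- One `g j₁` is nonzero at a point of the `i`-th axis, another one at a zero of `g j₁` in the
plane of the variables `i` and `k`. -/
theorem IsRegularDegreeSequence.exists_pair {n : ℕ} {d : Fin n → ℕ}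
    (h : IsRegularDegreeSequence d) (hd : ∀ j, 0 < d j) {i k : Fin n} (hik : i ≠ k) :
    ∃ j₁ j₂, j₁ ≠ j₂ ∧
      (∃ a b : ℕ, a * (i + 1) + b * (k + 1) = d j₁) ∧
      ∃ a b : ℕ, a * (i + 1) + b * (k + 1) = d j₂ := by
  obtain ⟨g, -, hg, hy⟩ := (isRegularDegreeSequence_iff_exists_isWeightedHomogeneous d).1 h
  have key (y : Fin n → ℂ) (hy0 : y ≠ 0) (hyI : ∀ l, y l ≠ 0 → l = i ∨ l = k) :
      ∃ j, eval y (g j) ≠ 0 ∧ ∃ a b : ℕ, a * (i + 1) + b * (k + 1) = d j := by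
    obtain ⟨j, hj⟩ := not_forall.1 fun h0 => hy0 ((hy y).1 h0)
    have := (hg j).mem_closure_of_eval_ne_zero (I := {i, k}) hyI hj
    rw [Set.image_pair, AddSubmonoid.mem_closure_pair] at this
    exact ⟨j, hj, this⟩
  obtain ⟨j₁, -, h₁⟩ := key (Pi.single i 1) (by simp)
    fun l hl => .inl (by by_contra h'; exact hl (Pi.single_eq_of_ne h' _))
  obtain ⟨y, hy0, hyI, hyg⟩ :=
    (hg j₁).exists_ne_zero_eval_eq_zero esymmWeight_ne_zero (hd j₁).ne' hik
  obtain ⟨j₂, hj₂, h₂⟩ := key y hy0 hyI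
  exact ⟨j₁, j₂, fun e => hj₂ (e ▸ hyg), h₁, h₂⟩

open scoped Classical in
/-- The sufficient condition for generic polynomials, applied to the weights `1, …, n`. -/
theorem isRegularDegreeSequence_of_card_le {n : ℕ} {d : Fin n → ℕ} (hd : ∀ j, 0 < d j)
    (h : ∀ I : Finset (Fin n), I.Nonempty → I.card ≤
      (Finset.univ.filter fun j => d j ∈ AddSubmonoid.closure (esymmWeight n '' I)).card) :
    IsRegularDegreeSequence d := by
  obtain ⟨g, hg, hg0, hgy⟩ :=
    exists_isWeightedHomogeneous_forall_eval_eq_zero _ esymmWeight_ne_zero d h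
  refine (isRegularDegreeSequence_iff_exists_isWeightedHomogeneous d).2
    ⟨g, fun j h0 => ?_, hg, fun y => ⟨hgy y, ?_⟩⟩
  -- `y₁ ^ d j` has weight `d j`, so it occurs in `g j`.
  · refine hg0 j (Finsupp.single ⟨0, j.pos⟩ (d j)) ?_ (by rw [h0, coeff_zero])
    simp [Finsupp.weight_single, esymmWeight]
  · rintro rfl j
    by_contra hj
    have := (hg j).mem_closure_of_eval_ne_zero (I := ∅) (fun l hl => hl rfl) hj
    rw [Set.image_empty, AddSubmonoid.closure_empty, AddSubmonoid.mem_bot] at this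
    exact (hd j).ne' this

/-! ### Sums of the weights in a set of variables -/

theorem mem_closure_of_zero_mem {n : ℕ} [NeZero n] {I : Set (Fin n)} (h : 0 ∈ I) (a : ℕ) :
    a ∈ AddSubmonoid.closure (esymmWeight n '' I) := by
  have := nsmul_mem (AddSubmonoid.subset_closure (Set.mem_image_of_mem (esymmWeight n) h)) a
  simpa [esymmWeight] using this

theorem mem_closure_of_dvd {n : ℕ} {I : Set (Fin n)} {i : Fin n} (h : i ∈ I) {a : ℕ}
    (ha : (i : ℕ) + 1 ∣ a) : a ∈ AddSubmonoid.closure (esymmWeight n '' I) := by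
  obtain ⟨b, rfl⟩ := ha
  rw [mul_comm]
  exact nsmul_mem (AddSubmonoid.subset_closure (Set.mem_image_of_mem (esymmWeight n) h)) b

theorem mem_closure_of_eq {n : ℕ} {I : Set (Fin n)} {i k : Fin n} (hi : i ∈ I) (hk : k ∈ I)
    {a x y : ℕ} (h : a = x * (i + 1) + y * (k + 1)) :
    a ∈ AddSubmonoid.closure (esymmWeight n '' I) :=
  h ▸ add_mem (mem_closure_of_dvd hi (dvd_mul_left _ _)) (mem_closure_of_dvd hk (dvd_mul_left _ _))

theorem exists_eq_two_mul_add_three_mul {a : ℕ} (h : a ≠ 1) : ∃ x y, a = x * 2 + y * 3 := by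
  rcases Nat.even_or_odd' a with ⟨b, rfl | rfl⟩
  · exact ⟨b, 0, by omega⟩
  · exact ⟨b - 1, 1, by omega⟩

theorem exists_eq_three_mul_add_four_mul {a : ℕ} (h₁ : a ≠ 1) (h₂ : a ≠ 2) (h₅ : a ≠ 5) :
    ∃ x y, a = x * 3 + y * 4 := by
  obtain h | h | h : a % 3 = 0 ∨ a % 3 = 1 ∨ a % 3 = 2 := by omega
  · exact ⟨a / 3, 0, by omega⟩
  · exact ⟨a / 3 - 1, 1, by omega⟩
  · exact ⟨a / 3 - 2, 2, by omega⟩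

/-! ### Permissible sequences -/

/-- The condition on the sets of weights `{i + 1, …, n}` that corresponds to `(†)`. -/
theorem DaggerCondition.le_add_card {n : ℕ} {d : Fin n → ℕ} (h : DaggerCondition d) {i : ℕ}
    (h₁ : 1 ≤ i) (hi : i ≤ n) : n ≤ i + (Finset.univ.filter fun j => i < d j).card := by
  have := Finset.card_filter_add_card_filter_not (s := Finset.univ) fun j => d j ≤ i
  simp only [not_le, Finset.card_univ, Fintype.card_fin] at this
  have := h i h₁ hi
  omega

theorem card_filter_le_add_card_le {n : ℕ} (d : Fin n → ℕ) {i : ℕ} (s : Finset (Fin n))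
    (hs : ∀ j ∈ s, i < d j) : (Finset.univ.filter fun j => d j ≤ i).card + s.card ≤ n := by
  rw [← Finset.card_union_of_disjoint (Finset.disjoint_left.2 fun j hj hjs =>
    (hs j hjs).not_ge (Finset.mem_filter.1 hj).2)]
  exact (Finset.card_le_univ _).trans_eq (Fintype.card_fin n)

theorem StarCondition.exists_dvd {n : ℕ} {d : Fin n → ℕ} (h : StarCondition d) {i : ℕ}
    (h₁ : 1 ≤ i) (hi : i ≤ n) : ∃ j, i ∣ d j := by
  obtain ⟨j, hj⟩ := Finset.card_pos.1 ((Nat.div_pos hi h₁).trans_le (h i h₁ hi))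
  exact ⟨j, (Finset.mem_filter.1 hj).2⟩

open scoped Classical in
/-- Only sets of variables without `y₁` need to be checked, and for a single variable the condition
is a case of `(*)`. -/
theorem StarCondition.isRegularDegreeSequence {n : ℕ} [NeZero n] {d : Fin n → ℕ}
    (h : StarCondition d) (hd : ∀ j, 0 < d j)
    (hI : ∀ I : Finset (Fin n), 0 ∉ I → 1 < I.card → I.card ≤
      (Finset.univ.filter fun j => d j ∈ AddSubmonoid.closure (esymmWeight n '' I)).card) :
    IsRegularDegreeSequence d := by
  refine isRegularDegreeSequence_of_card_le hd fun I hne => ?_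
  by_cases h0 : 0 ∈ I
  · rw [Finset.filter_true_of_mem fun j _ => mem_closure_of_zero_mem (by exact_mod_cast h0) _]
    exact Finset.card_le_univ I
  rcases (Nat.one_le_iff_ne_zero.2 hne.card_pos.ne').lt_or_eq with h1 | h1
  · exact hI I h0 h1
  obtain ⟨i, hi⟩ := hne
  obtain ⟨j, hj⟩ := h.exists_dvd (Nat.succ_pos i) i.2
  rw [← h1]
  exact Finset.card_pos.2
    ⟨j, Finset.mem_filter.2 ⟨Finset.mem_univ _, mem_closure_of_dvd (by exact_mod_cast hi) hj⟩⟩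

/-! ### Sequences of length two and three -/

/-- For `n ≤ 3` and `i ≥ 2` the bound `⌊n / i⌋` in `(*)` is `1`. -/
theorem IsRegularDegreeSequence.starCondition {n : ℕ} (hn : n ≤ 3) {d : Fin n → ℕ}
    (h : IsRegularDegreeSequence d) : StarCondition d := by
  intro i h₁ hi
  obtain rfl | h₂ := h₁.eq_or_lt
  · simp
  obtain ⟨j, hj⟩ := h.exists_dvd ⟨i - 1, by omega⟩
  have : n / i < 2 := (Nat.div_lt_iff_lt_mul h₁).2 (by omega)
  refine (Nat.le_of_lt_succ this).trans (Finset.card_pos.2 ⟨j, ?_⟩)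
  simpa [Nat.sub_add_cancel h₁] using hj

theorem StarCondition.daggerCondition_two {d : Fin 2 → ℕ} (hd : ∀ j, 0 < d j)
    (h : StarCondition d) : DaggerCondition d := by
  intro i h₁ hi
  obtain ⟨j, hj⟩ := h.exists_dvd one_le_two le_rfl
  have hj2 := Nat.le_of_dvd (hd j) hj
  obtain rfl | rfl : i = 1 ∨ i = 2 := by omega
  · have := card_filter_le_add_card_le d {j} (i := 1) fun k hk => by
      rw [Finset.mem_singleton.1 hk]; exact hj2
    rw [Finset.card_singleton] at this
    omega
  · exact Finset.card_le_univ _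

theorem IsRegularDegreeSequence.daggerCondition_three {d : Fin 3 → ℕ} (hd : ∀ j, 0 < d j)
    (h : IsRegularDegreeSequence d) : DaggerCondition d := by
  intro i h₁ hi
  obtain rfl | rfl | rfl : i = 1 ∨ i = 2 ∨ i = 3 := by omega
  · obtain ⟨j, k, hjk, ⟨a, b, hj⟩, a', b', hk⟩ := h.exists_pair hd (i := 1) (k := 2) (by decide)
    have := hd j
    have := hd k
    simp only [Fin.val_one, Fin.val_two] at hj hk
    have := card_filter_le_add_card_le d {j, k} (i := 1) (by
      simp only [Finset.mem_insert, Finset.mem_singleton, forall_eq_or_imp, forall_eq]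
      omega)
    rw [Finset.card_pair hjk] at this
    omega
  · obtain ⟨j, hj⟩ := h.exists_dvd 2
    have hj3 := Nat.le_of_dvd (hd j) hj
    have := card_filter_le_add_card_le d {j} (i := 2) fun k hk => by
      rw [Finset.mem_singleton.1 hk]; exact hj3
    rw [Finset.card_singleton] at this
    omega
  · exact Finset.card_le_univ _

theorem IsPermissible.isRegularDegreeSequence_three {d : Fin 3 → ℕ} (hd : ∀ j, 0 < d j)
    (h : IsPermissible d) : IsRegularDegreeSequence d := by
  classical
  refine h.1.isRegularDegreeSequence hd fun I h0 hI => ?_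
  obtain rfl : I = {1, 2} := by revert I; decide
  have h1 := h.2.le_add_card le_rfl (by norm_num)
  have h2 : 2 ≤ (Finset.univ.filter fun j => 1 < d j).card := by omega
  refine h2.trans (Finset.card_le_card
    (Finset.monotone_filter_right Finset.univ fun j _ hj => ?_))
  obtain ⟨x, y, e⟩ := exists_eq_two_mul_add_three_mul (a := d j) (ne_of_gt hj)
  exact mem_closure_of_eq (i := 1) (k := 2) (by simp) (by simp) e

/-! ### Sequences of length four -/

/-- If at most one degree is outside `{1, 2, 5}`, it is divisible by both `3` and `4`; then `(*)`
gives a degree `2` and `(†)` a degree `5` among the other three. -/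
theorem IsPermissible.isExceptional_of_card_le_one {d : Fin 4 → ℕ} (hd : ∀ j, 0 < d j)
    (h : IsPermissible d)
    (hc : (Finset.univ.filter fun j => d j ≠ 1 ∧ d j ≠ 2 ∧ d j ≠ 5).card ≤ 1) :
    IsExceptional d := by
  obtain ⟨j, hj⟩ := h.1.exists_dvd (i := 3) (by norm_num) (by norm_num)
  have hu (k) (h1 : d k ≠ 1) (h2 : d k ≠ 2) (h5 : d k ≠ 5) : k = j :=
    Finset.card_le_one.1 hc k (by simp [h1, h2, h5]) j (by
      have := hd j
      simp only [Finset.mem_filter, Finset.mem_univ, true_and]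
      omega)
  obtain ⟨k, hk⟩ := h.1.exists_dvd (i := 4) (by norm_num) (by norm_num)
  obtain rfl : k = j := by
    have := hd k
    exact hu k (by omega) (by omega) (by omega)
  obtain ⟨δ, hδ⟩ : 12 ∣ d k := by omega
  obtain ⟨a, ha, hak⟩ := Finset.exists_mem_ne (h.1 2 (by norm_num) (by norm_num)) k
  have ha2 : d a = 2 := by
    have h1 := (Finset.mem_filter.1 ha).2
    by_contra h2
    exact hak (hu a (by omega) h2 (by omega))
  obtain ⟨b, hb, hbk⟩ := Finset.exists_mem_ne (s := Finset.univ.filter fun j => 2 < d j) (by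
    have := h.2.le_add_card (i := 2) (by norm_num) (by norm_num)
    omega) k
  have hb5 : d b = 5 := by
    have h1 := (Finset.mem_filter.1 hb).2
    by_contra h2
    exact hbk (hu b (by omega) (by omega) h2)
  have hab : a ≠ b := by rintro rfl; omega
  obtain ⟨c, hc⟩ : ∃ c, c ∉ ({a, b, k} : Finset (Fin 4)) := by
    by_contra! hall
    have h1 := Finset.card_le_card fun c (_ : c ∈ Finset.univ) => hall c
    have h2 := h1.trans Finset.card_le_three
    simp at h2
  simp only [Finset.mem_insert, Finset.mem_singleton, not_or] at hc
  have hinj : Function.Injective ![c, a, b, k] := by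
    simp [Function.Injective, Fin.forall_fin_succ, hc, hab, hak, hbk, Ne.symm, eq_comm]
  refine ⟨δ, by have := hd k; omega, Equiv.ofBijective _ (Finite.injective_iff_bijective.1 hinj), ?_⟩
  have hcomp : d ∘ ![c, a, b, k] = ![d c, 2, 5, 12 * δ] := by
    funext i
    fin_cases i <;> simp [ha2, hb5, hδ]
  have hc' : d c = 1 ∨ d c = 2 ∨ d c = 5 := by
    by_contra! h'
    exact hc.2.2 (hu c h'.1 h'.2.1 h'.2.2)
  rw [Equiv.coe_ofBijective, hcomp]
  rcases hc' with h' | h' | h' <;> simp [h']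

theorem IsPermissible.isRegularDegreeSequence_four {d : Fin 4 → ℕ} (hd : ∀ j, 0 < d j)
    (h : IsPermissible d) (he : ¬ IsExceptional d) : IsRegularDegreeSequence d := by
  classical
  refine h.1.isRegularDegreeSequence hd fun I h0 hI => ?_
  have h1 : 3 ≤ (Finset.univ.filter fun j => 1 < d j).card := by
    have := h.2.le_add_card le_rfl (by norm_num)
    omega
  have h2 := h.1 2 (by norm_num) (by norm_num)
  have h3 : 2 ≤ (Finset.univ.filter fun j => d j ≠ 1 ∧ d j ≠ 2 ∧ d j ≠ 5).card := by
    by_contra! hlt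
    exact he (h.isExceptional_of_card_le_one hd (by omega))
  have h23 (I : Set (Fin 4)) (hI₁ : 1 ∈ I) (hI₂ : 2 ∈ I) (j : Fin 4) (hj : 1 < d j) :
      d j ∈ AddSubmonoid.closure (esymmWeight 4 '' I) := by
    obtain ⟨x, y, e⟩ := exists_eq_two_mul_add_three_mul (a := d j) (ne_of_gt hj)
    exact mem_closure_of_eq hI₁ hI₂ e
  obtain rfl | rfl | rfl | rfl : I = {1, 2} ∨ I = {1, 3} ∨ I = {2, 3} ∨ I = {1, 2, 3} := by
    revert I; decide
  · refine (Nat.le_of_succ_le h1).trans (Finset.card_le_card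
      (Finset.monotone_filter_right Finset.univ fun j _ hj => ?_))
    exact h23 _ (by simp) (by simp) j hj
  · refine h2.trans (Finset.card_le_card
      (Finset.monotone_filter_right Finset.univ fun j _ hj => ?_))
    exact mem_closure_of_dvd (i := 1) (by simp) hj
  · refine h3.trans (Finset.card_le_card
      (Finset.monotone_filter_right Finset.univ fun j _ hj => ?_))
    obtain ⟨x, y, e⟩ := exists_eq_three_mul_add_four_mul hj.1 hj.2.1 hj.2.2
    exact mem_closure_of_eq (i := 2) (k := 3) (by simp) (by simp) e
  · refine h1.trans (Finset.card_le_card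
      (Finset.monotone_filter_right Finset.univ fun j _ hj => ?_))
    exact h23 _ (by simp) (by simp) j hj

theorem card_filter_comp_perm {n : ℕ} (d : Fin n → ℕ) (σ : Equiv.Perm (Fin n)) (p : ℕ → Prop)
    [DecidablePred p] : (Finset.univ.filter fun j => p ((d ∘ σ) j)).card =
      (Finset.univ.filter fun j => p (d j)).card := by
  rw [Finset.card_filter, Finset.card_filter]
  exact Equiv.sum_comp σ fun j => if p (d j) then 1 else 0

theorem isPermissible_comp_perm {n : ℕ} {d : Fin n → ℕ} (σ : Equiv.Perm (Fin n)) :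
    IsPermissible (d ∘ σ) ↔ IsPermissible d := by
  refine and_congr (forall₃_congr fun i _ _ => ?_) (forall₃_congr fun i _ _ => ?_)
  · rw [card_filter_comp_perm d σ (i ∣ ·)]
  · rw [card_filter_comp_perm d σ (· ≤ i)]

theorem card_filter_vec_four (p : ℕ → Prop) [DecidablePred p] (a b c e : ℕ) :
    (Finset.univ.filter fun j => p (![a, b, c, e] j)).card =
      (if p a then 1 else 0) + (if p b then 1 else 0) + (if p c then 1 else 0) +
        if p e then 1 else 0 := by
  rw [Finset.card_filter, Fin.sum_univ_four]
  rfl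

theorem isPermissible_vec {x δ : ℕ} (hx : x = 1 ∨ x = 2 ∨ x = 5) (hδ : 0 < δ) :
    IsPermissible ![x, 2, 5, 12 * δ] := by
  refine ⟨fun i h₁ hi => ?_, fun i h₁ hi => ?_⟩
  · have h : i ∣ 12 * δ := by interval_cases i <;> omega
    rw [card_filter_vec_four (i ∣ ·), if_pos h]
    interval_cases i <;> obtain rfl | rfl | rfl := hx <;> decide
  · have h : ¬ 12 * δ ≤ i := by omega
    rw [card_filter_vec_four (· ≤ i), if_neg h]
    interval_cases i <;> obtain rfl | rfl | rfl := hx <;> decide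

theorem IsExceptional.exists_perm {d : Fin 4 → ℕ} (h : IsExceptional d) :
    ∃ x δ : ℕ, (x = 1 ∨ x = 2 ∨ x = 5) ∧ 0 < δ ∧ ∃ σ : Equiv.Perm (Fin 4),
      d ∘ σ = ![x, 2, 5, 12 * δ] := by
  obtain ⟨δ, hδ, σ, h | h | h⟩ := h
  exacts [⟨1, δ, by simp, hδ, σ, h⟩, ⟨2, δ, by simp, hδ, σ, h⟩, ⟨5, δ, by simp, hδ, σ, h⟩]

theorem IsExceptional.isPermissible {d : Fin 4 → ℕ} (h : IsExceptional d) : IsPermissible d := by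
  obtain ⟨x, δ, hx, hδ, σ, e⟩ := h.exists_perm
  rw [← isPermissible_comp_perm σ, e]
  exact isPermissible_vec hx hδ

/-- Only the degree `12 * δ` is a sum of `3`s and `4`s. -/
theorem IsExceptional.not_isRegularDegreeSequence {d : Fin 4 → ℕ} (hd : ∀ j, 0 < d j)
    (h : IsExceptional d) : ¬ IsRegularDegreeSequence d := by
  intro hr
  obtain ⟨x, δ, hx, hδ, σ, e⟩ := h.exists_perm
  have key (j : Fin 4) (hj : ∃ a b : ℕ, a * 3 + b * 4 = d j) : j = σ 3 := by
    obtain ⟨a, b, hj⟩ := hj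
    obtain ⟨i, rfl⟩ := σ.surjective j
    have h1 : d (σ i) = ![x, 2, 5, 12 * δ] i := congrFun e i
    rw [h1] at hj
    fin_cases i <;> simp only [Fin.reduceFinMk, Fin.zero_eta, Fin.mk_one, Matrix.cons_val] at hj
    · omega
    · omega
    · omega
    · rfl
  obtain ⟨j, k, hjk, hj, hk⟩ := hr.exists_pair hd (i := 2) (k := 3) (by decide)
  exact hjk ((key j hj).trans (key k hk).symm)

end SymRegSeq

end

theorem theorem2p4 :
    (∀ d : Fin 2 → ℕ, (∀ i, 0 < d i) →
      (SymRegSeq.IsRegularDegreeSequence d ↔ SymRegSeq.IsPermissible d) ∧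
        (SymRegSeq.IsPermissible d ↔ SymRegSeq.StarCondition d)) ∧
    (∀ d : Fin 3 → ℕ, (∀ i, 0 < d i) →
      (SymRegSeq.IsRegularDegreeSequence d ↔ SymRegSeq.IsPermissible d)) ∧
    (∀ d : Fin 4 → ℕ, (∀ i, 0 < d i) →
      (SymRegSeq.IsPermissible d → ¬ SymRegSeq.IsExceptional d →
        SymRegSeq.IsRegularDegreeSequence d) ∧
      (SymRegSeq.IsExceptional d →
        SymRegSeq.IsPermissible d ∧ ¬ SymRegSeq.IsRegularDegreeSequence d)) := by
  refine ⟨fun d hd => ?_, fun d hd => ?_, fun d hd => ?_⟩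
  · have hp : SymRegSeq.IsPermissible d ↔ SymRegSeq.StarCondition d :=
      ⟨fun h => h.1, fun h => ⟨h, h.daggerCondition_two hd⟩⟩
    refine ⟨?_, hp⟩
    rw [hp]
    refine ⟨fun h => h.starCondition (by norm_num), fun h => ?_⟩
    refine h.isRegularDegreeSequence hd fun I h0 hI => absurd hI ?_
    revert I
    decide
  · exact ⟨fun h => ⟨h.starCondition le_rfl, h.daggerCondition_three hd⟩,
      fun h => h.isRegularDegreeSequence_three hd⟩
  · exact ⟨fun h he => h.isRegularDegreeSequence_four hd he,
      fun h => ⟨h.isPermissible, h.not_isRegularDegreeSequence hd⟩⟩
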